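/- Let $K\ge 0$, let $U\subseteq\mathbb{R}^K$ be open, and let $L$ be a finite-dimensional semisimple real Lie algebra of smooth vector fields on $U$ (under the bracket of vector fields). Suppose that $L$ has a Cartan subalgebra $C$ such that, for every $h\in C$, all eigenvalues of $\operatorname{ad}_L h$ are real. Let $B\supseteq C$ be a Borel subalgebra of $L$ (a maximal solvable subalgebra) and let $\mathfrak{N}$ be the nilradical (the largest nilpotent ideal) of $B$. Suppose that $\mathfrak{N}$ contains an abelian subalgebra $A$ of rank $K$. Here the rank of a Lie algebra of vector fields on $U$ is the dimension of its generic orbit: it is $r$ if the orbits through the points of some open dense subset of $U$ have dimension $r$ and the orbits through all other points of $U$ have dimension less than $r$; the dimension of the orbit through $x$ is $\dim\{X(x): X\in A\}$. Then $L$ cannot occur as a proper Levi complement of any finite-dimensional Lie algebra of local vector fields on $\mathbb{R}^K$ containing it. That is, for every open $V\subseteq U$ and every finite-dimensional Lie algebra $\mathfrak{g}$ of smooth vector fields on $V$ that contains the algebra $L|_V$ of restrictions to $V$ of the elements of $L$, the subalgebra $L|_V$ is not a proper Levi complement of $\mathfrak{g}$. Here a Levi complement of $\mathfrak g$ is a semisimple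 subalgebra $S$ with $\mathfrak{g}=S\oplus\operatorname{rad}\mathfrak{g}$ as vector spaces, and it is proper if $S\ne 0$ and $S\neq\mathfrak{g}$. -/

import Mathlib

open scoped ContDiff
open TopologicalSpace (Opens)

/-- The smooth vector fields on an open set `U` of `ℝ^K`.  A vector field is given by its
coefficient function, and two functions that agree on `U` have to count as the same vector field:
we take the representative that is zero outside `U`. -/
def smoothVectorFields {K : ℕ} (U : Opens (EuclideanSpace ℝ (Fin K))) :
    Submodule ℝ (EuclideanSpace ℝ (Fin K) → EuclideanSpace ℝ (Fin K)) where
  carrier := {X | ContDiffOn ℝ ∞ X U ∧ ∀ x ∉ U, X x = 0}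
  add_mem' hX hY := ⟨hX.1.add hY.1, fun x hx => by simp [hX.2 x hx, hY.2 x hx]⟩
  zero_mem' := ⟨contDiffOn_const, fun _ _ => rfl⟩
  smul_mem' c X hX := ⟨contDiffOn_const.smul hX.1, fun x hx => by simp [hX.2 x hx]⟩

/-- The type of smooth vector fields on an open set `U` of `ℝ^K`. -/
abbrev SmoothVF {K : ℕ} (U : Opens (EuclideanSpace ℝ (Fin K))) : Type :=
  ↥(smoothVectorFields U)

namespace SmoothVF

variable {K : ℕ} {U V : Opens (EuclideanSpace ℝ (Fin K))}

theorem contDiffAt (X : SmoothVF U) {x : EuclideanSpace ℝ (Fin K)} (hx : x ∈ U) :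
    ContDiffAt ℝ ∞ X.1 x :=
  X.2.1.contDiffAt (U.isOpen.mem_nhds hx)

theorem differentiableAt (X : SmoothVF U) {x : EuclideanSpace ℝ (Fin K)} (hx : x ∈ U) :
    DifferentiableAt ℝ X.1 x :=
  (X.contDiffAt hx).differentiableAt (by simp)

/-- The usual bracket of vector fields, `[X, Y](x) = DY(x) (X x) - DX(x) (Y x)`
(it is automatically zero at the points outside `U`). -/
noncomputable instance : Bracket (SmoothVF U) (SmoothVF U) where
  bracket X Y := ⟨VectorField.lieBracket ℝ X.1 Y.1,
    fun _ hx => (((X.contDiffAt hx).lieBracket_vectorField (m := ∞)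
      (Y.contDiffAt hx) (by simp))).contDiffWithinAt,
    fun x hx => VectorField.lieBracket_eq_zero_of_eq_zero (X.2.2 x hx) (Y.2.2 x hx)⟩

theorem coe_bracket (X Y : SmoothVF U) :
    (⁅X, Y⁆ : SmoothVF U).1 = VectorField.lieBracket ℝ X.1 Y.1 := rfl

theorem ext_on {X Y : SmoothVF U} (h : ∀ x ∈ U, X.1 x = Y.1 x) : X = Y := by
  ext1
  funext x
  by_cases hx : x ∈ U
  · exact h x hx
  · rw [X.2.2 x hx, Y.2.2 x hx]

noncomputable instance : LieRing (SmoothVF U) where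
  add_lie X Y Z := ext_on fun x hx => by
    have := VectorField.lieBracket_add_left (𝕜 := ℝ) (W := Z.1)
      (X.differentiableAt hx) (Y.differentiableAt hx)
    simpa [coe_bracket] using this
  lie_add X Y Z := ext_on fun x hx => by
    have := VectorField.lieBracket_add_right (𝕜 := ℝ) (V := X.1)
      (Y.differentiableAt hx) (Z.differentiableAt hx)
    simpa [coe_bracket] using this
  lie_self X := Subtype.ext (by simp [coe_bracket])
  leibniz_lie X Y Z := ext_on fun x hx => by
    have h2 : minSmoothness ℝ 2 ≤ (∞ : WithTop ℕ∞) := by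
      simp only [minSmoothness_of_isRCLikeNormedField]
      exact WithTop.coe_le_coe.2 le_top
    have := VectorField.leibniz_identity_lieBracket (𝕜 := ℝ) h2
      (X.contDiffAt hx) (Y.contDiffAt hx) (Z.contDiffAt hx)
    simpa [coe_bracket] using this

noncomputable instance : LieAlgebra ℝ (SmoothVF U) where
  lie_smul c X Y := ext_on fun x hx => by
    have := VectorField.lieBracket_const_smul_right (𝕜 := ℝ) (V := X.1) (c := c)
      (Y.differentiableAt hx)
    simpa [coe_bracket] using this

open Classical in
/-- Restriction of smooth vector fields from `U` to a smaller open set `V`. -/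
noncomputable def restrict (h : V ≤ U) : SmoothVF U →ₗ⁅ℝ⁆ SmoothVF V where
  toFun X := ⟨fun x => if x ∈ V then X.1 x else 0,
    (X.2.1.mono h).congr fun x hx => if_pos hx, fun x hx => if_neg hx⟩
  map_add' X Y := ext_on fun x hx => by simp [hx]
  map_smul' c X := ext_on fun x hx => by simp [hx]
  map_lie' {X Y} := ext_on fun x hx => by
    have key : ∀ Z : SmoothVF U, (fun y => if y ∈ V then Z.1 y else 0) =ᶠ[nhds x] Z.1 :=
      fun Z => Filter.eventuallyEq_of_mem (V.isOpen.mem_nhds hx) fun y hy => if_pos hy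
    simp only [coe_bracket, hx, if_true]
    exact ((key X).lieBracket_vectorField_eq (key Y)).symm

theorem restrict_apply (h : V ≤ U) (X : SmoothVF U) {x : EuclideanSpace ℝ (Fin K)}
    (hx : x ∈ V) : (restrict h X).1 x = X.1 x := if_pos hx

end SmoothVF

/-- The dimension of the orbit through `x` of a Lie algebra `A` of vector fields: the tangent
space of the orbit at `x` consists of the values at `x` of the members of `A`. -/
noncomputable def orbitDim {K : ℕ} {U : Opens (EuclideanSpace ℝ (Fin K))}
    (A : LieSubalgebra ℝ (SmoothVF U)) (x : EuclideanSpace ℝ (Fin K)) : ℕ :=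
  Module.finrank ℝ (Submodule.span ℝ {v : EuclideanSpace ℝ (Fin K) | ∃ X ∈ A, X.1 x = v})

/-- `A` has rank `r`: its generic orbits have dimension `r`, that is, the orbits have dimension
`r` on an open dense subset of `U`, and lower dimension at the other points of `U`. -/
def HasRank {K : ℕ} {U : Opens (EuclideanSpace ℝ (Fin K))}
    (A : LieSubalgebra ℝ (SmoothVF U)) (r : ℕ) : Prop :=
  ∃ O : Opens (EuclideanSpace ℝ (Fin K)), O ≤ U ∧
    (U : Set (EuclideanSpace ℝ (Fin K))) ⊆ closure (O : Set (EuclideanSpace ℝ (Fin K))) ∧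
    (∀ x ∈ O, orbitDim A x = r) ∧ ∀ x ∈ U, x ∉ O → orbitDim A x < r

section LieTheory

variable {𝔤 : Type*} [LieRing 𝔤] [LieAlgebra ℝ 𝔤]

/-- A split Cartan subalgebra: a Cartan subalgebra all of whose elements have only real
eigenvalues in the adjoint representation of the whole algebra. -/
def IsSplitCartan [FiniteDimensional ℝ 𝔤] (C : LieSubalgebra ℝ 𝔤) : Prop :=
  C.IsCartanSubalgebra ∧ ∀ h ∈ C, (LieAlgebra.ad ℝ 𝔤 h).charpoly.Splits

/-- A Borel subalgebra: a maximal solvable subalgebra. -/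
def IsBorel (B : LieSubalgebra ℝ 𝔤) : Prop :=
  Maximal (fun S : LieSubalgebra ℝ 𝔤 => LieAlgebra.IsSolvable S) B

/-- `N` is the nilradical of the Lie algebra: its largest nilpotent ideal. -/
def IsNilradical (N : LieIdeal ℝ 𝔤) : Prop :=
  IsGreatest {I : LieIdeal ℝ 𝔤 | LieRing.IsNilpotent I} N

/-- A Levi complement: a semisimple subalgebra that is a vector space complement of the
radical. -/
def IsLeviComplement (S : LieSubalgebra ℝ 𝔤) : Prop :=
  LieAlgebra.IsSemisimple ℝ S ∧
    IsCompl S.toSubmodule (LieAlgebra.radical ℝ 𝔤).toSubmodule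

/-- A proper Levi complement is one that is neither zero nor the whole algebra. -/
def IsProperLeviComplement (S : LieSubalgebra ℝ 𝔤) : Prop :=
  IsLeviComplement S ∧ S ≠ ⊥ ∧ S ≠ ⊤

end LieTheory

/-!
Suppose that `L|_V` is a proper Levi complement of `G`. Then the radical `R` of `G` is nonzero, and
`L` acts on it through the bracket of `G`. The nilradical `N` of the Borel subalgebra acts
nilpotently on every finite-dimensional `L`-module
(`LieAlgebra.isNilpotent_toEnd_of_mem_nilradical`), so by Engel's theorem some nonzero `Y ∈ R`
commutes with `N`, and in particular with `A`. At a generic point `x` the commuting fields of `A`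
span the tangent space, so that near `x` the field `Y` is a combination of them with constant
coefficients (`SmoothVF.eventually_eq_sum_of_lie_eq_zero`). On a neighbourhood `W` of `x` it
therefore belongs to the image of `L` as well as to the image of the solvable ideal `R`. As `L` is
semisimple, `Y` is zero on `W` (`LieAlgebra.IsSemisimple.map_eq_zero_of_mem_range`). Generic points
are dense, so `Y = 0`, a contradiction. Working with germs at generic points makes connectedness
of `V` irrelevant.

The nilpotency of the action of `N` does not need the structure theory of root systems. An element
`x` of a perfect Lie algebra with `ad x` nilpotent acts nilpotently on every module, because its
generalized eigenspaces are submodules and the trace of `x` on a module over a perfect Lie algebra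
is zero (`LieModule.isNilpotent_toEnd_of_isNilpotent_ad`). The ideal `N` is the sum of its
intersections with the weight spaces of the Cartan subalgebra `C`. Its components for nonzero
weights are ad-nilpotent. An element `h` of `N ∩ C` is ad-nilpotent as well: the Borel subalgebra
is annihilated by a power of `ad h`, and if `ad h` had a nonzero eigenvalue, which is real as `C` is
split, the generalized eigenspace of an extreme one could be added to the Borel subalgebra
(`LieAlgebra.isNilpotent_ad_of_isBorel_le`). Finally, inside the nilpotent algebra `N` the elements
that act nilpotently are closed under addition (`LieModule.isNilpotent_toEnd_add`).
-/

/-! ### Nilpotent actions and traces -/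

open Module Polynomial in
/-- If the characteristic polynomial splits, then the space is the sum of the generalized
eigenspaces: the characteristic polynomial annihilates the space, and the kernels of its coprime
factors add up to the kernel of their product. -/
theorem Module.End.iSup_maxGenEigenspace_eq_top_of_splits {k V : Type*} [Field k]
    [AddCommGroup V] [Module k V] [FiniteDimensional k V] {f : Module.End k V}
    (hf : f.charpoly.Splits) : ⨆ μ, f.maxGenEigenspace μ = ⊤ := by
  classical
  have key : ∀ s : Finset k, ∀ n : k → ℕ,
      LinearMap.ker (aeval f (∏ a ∈ s, (X - C a) ^ n a)) ≤ ⨆ μ, f.maxGenEigenspace μ := by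
    intro s n
    induction s using Finset.induction_on with
    | empty =>
      rw [Finset.prod_empty, map_one]
      exact (LinearMap.ker_eq_bot_of_injective Function.injective_id).trans_le bot_le
    | insert a s ha ih =>
      have hcop : IsCoprime ((X - C a) ^ n a) (∏ b ∈ s, (X - C b) ^ n b) := by
        refine IsCoprime.prod_right fun b hb => IsCoprime.pow ?_
        exact isCoprime_X_sub_C_of_isUnit_sub
          (sub_ne_zero.2 (by rintro rfl; exact ha hb)).isUnit
      rw [Finset.prod_insert ha, ← Polynomial.sup_ker_aeval_eq_ker_aeval_mul_of_coprime f hcop]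
      refine sup_le (le_trans ?_ (le_iSup _ a)) ih
      intro v hv
      rw [Module.End.mem_maxGenEigenspace]
      refine ⟨n a, ?_⟩
      simpa [Algebra.algebraMap_eq_smul_one] using hv
  rw [eq_top_iff]
  refine le_trans ?_ (key f.charpoly.roots.toFinset (fun a => f.charpoly.roots.count a))
  rw [← Finset.prod_multiset_map_count,
    ← hf.eq_prod_roots_of_monic f.charpoly_monic, LinearMap.aeval_self_charpoly]
  simp

namespace LieModule

section AlgClosed

variable {k L M : Type*} [Field k] [CharZero k] [LieRing L] [LieAlgebra k L]
  [AddCommGroup M] [Module k M] [LieRingModule L M] [LieModule k L M] [FiniteDimensional k M]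

/-- If `x` is ad-nilpotent, its generalized eigenspaces on `M` are submodules; if moreover `x` has
trace zero on every submodule, then only the eigenvalue zero occurs, since the trace of `x` on the
generalized eigenspace of `μ` is `μ` times its dimension. -/
theorem isNilpotent_toEnd_of_trace_eq_zero [IsTriangularizable k L M] {x : L}
    (hx : ∀ y : L, y ∈ (LieAlgebra.ad k L x).maxGenEigenspace 0)
    (htr : ∀ W : LieSubmodule k L M, LinearMap.trace k W (toEnd k L W x) = 0) :
    _root_.IsNilpotent (toEnd k L M x) := by
  have hzero : ∀ μ : k, μ ≠ 0 → (toEnd k L M x).maxGenEigenspace μ = ⊥ := by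
    intro μ hμ
    let W : LieSubmodule k L M :=
      { (toEnd k L M x).maxGenEigenspace μ with
        lie_mem := fun {y m} hm => by
          have := lie_mem_maxGenEigenspace_toEnd (hx y) hm
          rwa [zero_add] at this }
    have hnil : _root_.IsNilpotent (toEnd k L W x - μ • LinearMap.id) := by
      have h := Module.End.isNilpotent_restrict_maxGenEigenspace_sub_algebraMap
        (toEnd k L M x) μ
      exact h
    have h0 := (LinearMap.isNilpotent_trace_of_isNilpotent hnil).eq_zero
    rw [map_sub, htr W, map_smul, LinearMap.trace_id, zero_sub, neg_eq_zero, smul_eq_mul,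
      mul_eq_zero, or_iff_right hμ, Nat.cast_eq_zero] at h0
    have : (W : Submodule k M) = ⊥ := Submodule.finrank_eq_zero.1 h0
    exact this
  have htop := IsTriangularizable.maxGenEigenspace_eq_top (R := k) (L := L) (M := M) x
  have h1 : (toEnd k L M x).maxGenEigenspace 0 = ⊤ := by
    rw [eq_top_iff, ← htop]
    refine iSup_le fun μ => ?_
    by_cases hμ : μ = 0
    · rw [hμ]
    · rw [hzero μ hμ]; exact bot_le
  refine Module.End.isNilpotent_iff_of_finite.mpr fun m => ?_
  have hm : m ∈ (toEnd k L M x).maxGenEigenspace 0 := h1 ▸ Submodule.mem_top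
  simpa [Module.End.mem_maxGenEigenspace] using hm

end AlgClosed

open TensorProduct

variable {L M : Type*} [LieRing L] [LieAlgebra ℝ L]
  [AddCommGroup M] [Module ℝ M] [LieRingModule L M] [LieModule ℝ L M]

theorem isNilpotent_toEnd_tmul_iff {x : L} :
    _root_.IsNilpotent (toEnd ℂ (ℂ ⊗[ℝ] L) (ℂ ⊗[ℝ] M) (1 ⊗ₜ x)) ↔
      _root_.IsNilpotent (toEnd ℝ L M x) := by
  have hinj : Function.Injective (Module.End.baseChangeHom ℝ ℂ M) :=
    LinearMap.baseChangeHom_injective ℝ M ℂ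
  rw [← _root_.IsNilpotent.map_iff hinj, toEnd_baseChange]
  rfl

theorem mem_maxGenEigenspace_ad_tmul {x : L} (hx : _root_.IsNilpotent (LieAlgebra.ad ℝ L x))
    (y : ℂ ⊗[ℝ] L) : y ∈ (LieAlgebra.ad ℂ (ℂ ⊗[ℝ] L) (1 ⊗ₜ x)).maxGenEigenspace 0 := by
  obtain ⟨n, hn⟩ := (isNilpotent_toEnd_tmul_iff (M := L)).2 hx
  rw [Module.End.mem_maxGenEigenspace]
  refine ⟨n, ?_⟩
  rw [zero_smul, sub_zero]
  exact congrArg (fun f => f y) hn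

variable [FiniteDimensional ℝ M]

/-- An ad-nilpotent element of a perfect real Lie algebra acts nilpotently on every
finite-dimensional module. Real eigenvalues need not exist, so the trace argument is carried out
after extending scalars to `ℂ`. -/
theorem isNilpotent_toEnd_of_isNilpotent_ad (hL : LieAlgebra.derivedSeries ℝ L 1 = ⊤) {x : L}
    (hx : _root_.IsNilpotent (LieAlgebra.ad ℝ L x)) : _root_.IsNilpotent (toEnd ℝ L M x) := by
  rw [← isNilpotent_toEnd_tmul_iff]
  refine isNilpotent_toEnd_of_trace_eq_zero (mem_maxGenEigenspace_ad_tmul hx) fun W => ?_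
  refine trace_toEnd_eq_zero_of_mem_lcs ℂ (ℂ ⊗[ℝ] L) W (k := 1) le_rfl ?_
  have h : LieAlgebra.derivedSeries ℂ (ℂ ⊗[ℝ] L) 1 = ⊤ := by
    rw [LieAlgebra.derivedSeries_baseChange, hL, LieSubmodule.baseChange_top]
  have h2 : (1 ⊗ₜ x : ℂ ⊗[ℝ] L) ∈ LieAlgebra.derivedSeries ℂ (ℂ ⊗[ℝ] L) 1 :=
    h ▸ LieSubmodule.mem_top _
  simpa using h2

/-- The elements of a nilpotent Lie algebra that act nilpotently on a finite-dimensional module are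
closed under addition. -/
theorem isNilpotent_toEnd_add [LieRing.IsNilpotent L] {x y : L}
    (hx : _root_.IsNilpotent (toEnd ℝ L M x)) (hy : _root_.IsNilpotent (toEnd ℝ L M y)) :
    _root_.IsNilpotent (toEnd ℝ L M (x + y)) := by
  have had : _root_.IsNilpotent (LieAlgebra.ad ℝ L (x + y)) :=
    isNilpotent_toEnd_of_isNilpotent ℝ L L _
  have hW : ∀ (W : LieSubmodule ℂ (ℂ ⊗[ℝ] L) (ℂ ⊗[ℝ] M)) (z : L),
      _root_.IsNilpotent (toEnd ℝ L M z) →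
      LinearMap.trace ℂ W (toEnd ℂ (ℂ ⊗[ℝ] L) W (1 ⊗ₜ z)) = 0 := by
    intro W z hz
    obtain ⟨n, hn⟩ := isNilpotent_toEnd_tmul_iff.2 hz
    refine (LinearMap.isNilpotent_trace_of_isNilpotent ⟨n, ?_⟩).eq_zero
    ext w : 1
    apply Subtype.ext
    have := congrArg (fun f => f (w : ℂ ⊗[ℝ] M)) hn
    simp only [LinearMap.zero_apply] at this ⊢
    rw [LieSubmodule.coe_toEnd_pow, this]
    rfl
  rw [← isNilpotent_toEnd_tmul_iff]
  refine isNilpotent_toEnd_of_trace_eq_zero (mem_maxGenEigenspace_ad_tmul had) fun W => ?_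
  rw [TensorProduct.tmul_add, map_add, map_add, hW W x hx, hW W y hy, add_zero]

end LieModule

/-! ### Perfect ideals and solvable extensions -/

namespace LieAlgebra

section General

variable {R L L' : Type*} [CommRing R] [LieRing L] [LieAlgebra R L] [LieRing L'] [LieAlgebra R L']

/-- Every ideal `I` of a semisimple Lie algebra is perfect: a complement of `⁅I, I⁆` in the lattice
of ideals meets `I` in an abelian ideal, which is zero. -/
theorem IsSemisimple.lie_self_eq [IsSemisimple R L] (I : LieIdeal R L) : ⁅I, I⁆ = I := by
  obtain ⟨Z, hZ⟩ := exists_isCompl (⁅I, I⁆ : LieIdeal R L)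
  have hDI : ⁅I, I⁆ ≤ I := LieSubmodule.lie_le_right _ _
  have habel : IsLieAbelian (I ⊓ Z : LieIdeal R L) := by
    rw [LieSubmodule.lie_abelian_iff_lie_self_eq_bot, eq_bot_iff, ← hZ.inf_eq_bot]
    exact le_inf (LieSubmodule.mono_lie inf_le_left inf_le_left)
      ((LieSubmodule.lie_le_right _ _).trans inf_le_right)
  have hbot : I ⊓ Z = ⊥ := HasTrivialRadical.eq_bot_of_isSolvable _
  refine le_antisymm hDI ?_
  calc I = (⁅I, I⁆ ⊔ Z) ⊓ I := by rw [hZ.sup_eq_top, top_inf_eq]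
    _ = ⁅I, I⁆ ⊔ Z ⊓ I := (sup_inf_assoc_of_le Z hDI)
    _ ≤ ⁅I, I⁆ := by rw [inf_comm, hbot, sup_bot_eq]

theorem IsSemisimple.derivedSeries_eq_top [IsSemisimple R L] (k : ℕ) :
    derivedSeries R L k = ⊤ :=
  LieIdeal.derivedSeries_eq_top k (IsSemisimple.lie_self_eq ⊤)

theorem isSolvable_of_ker (f : L →ₗ⁅R⁆ L') [IsSolvable L'] [IsSolvable f.ker] : IsSolvable L := by
  obtain ⟨k, hk⟩ := IsSolvable.solvable R L'
  have h : derivedSeries R L k ≤ f.ker := by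
    have h1 := LieIdeal.derivedSeries_map_le (f := f) k
    rw [hk, le_bot_iff] at h1
    intro x hx
    have h2 : f x ∈ (derivedSeries R L k).map f := LieIdeal.mem_map hx
    rw [h1] at h2
    simpa using h2
  have h3 : IsSolvable (derivedSeries R L k) := le_solvable_ideal_solvable h inferInstance
  obtain ⟨l, hl⟩ := IsSolvable.solvable R (derivedSeries R L k)
  rw [LieIdeal.derivedSeries_eq_bot_iff] at hl
  refine IsSolvable.mk (R := R) (k := l + k) ?_
  rw [derivedSeries_def, derivedSeriesOfIdeal_add]
  exact hl

/-- If a solvable subalgebra `B` normalizes an abelian subspace `P`, then the subalgebra `B + P` is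
solvable, as `P` is an ideal of it and the quotient by `P` is an image of `B`. -/
theorem isSolvable_of_sup {B Q : LieSubalgebra R L} [IsSolvable B] {P : Submodule R L}
    (hQ : Q.toSubmodule = B.toSubmodule ⊔ P) (hBP : ∀ b ∈ B, ∀ p ∈ P, ⁅b, p⁆ ∈ P)
    (hPP : ∀ p ∈ P, ∀ q ∈ P, ⁅p, q⁆ = 0) : IsSolvable Q := by
  have hmem : ∀ x : L, x ∈ Q ↔ ∃ b ∈ B, ∃ p ∈ P, b + p = x := fun x => by
    rw [← LieSubalgebra.mem_toSubmodule, hQ, Submodule.mem_sup]; rfl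
  let I : LieIdeal R Q :=
    { P.comap Q.toSubmodule.subtype with
      lie_mem := by
        rintro ⟨x, hx⟩ ⟨m, hm⟩ (hmP : m ∈ P)
        obtain ⟨b, hb, p, hp, rfl⟩ := (hmem x).1 hx
        change ⁅b + p, m⁆ ∈ P
        rw [add_lie, hPP p hp m hmP, add_zero]
        exact hBP b hb m hmP }
  have hBQ : B ≤ Q := by
    rw [← LieSubalgebra.toSubmodule_le_toSubmodule, hQ]; exact le_sup_left
  have hIab : IsLieAbelian I := ⟨fun x y => by
    ext1; ext1
    exact hPP _ x.2 _ y.2⟩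
  let f : Q →ₗ⁅R⁆ Q ⧸ I :=
    { (LieSubmodule.Quotient.mk' I : Q →ₗ[R] Q ⧸ I) with
      map_lie' := fun {x y} => LieSubmodule.Quotient.mk_bracket I x y }
  have hf : f.ker = I := by
    ext x
    exact LieSubmodule.Quotient.mk_eq_zero I
  have hsurj : Function.Surjective (f.comp (LieSubalgebra.inclusion hBQ)) := by
    intro y
    obtain ⟨⟨x, hx⟩, rfl⟩ := LieSubmodule.Quotient.surjective_mk' I y
    obtain ⟨b, hb, p, hp, rfl⟩ := (hmem x).1 hx
    refine ⟨⟨b, hb⟩, ?_⟩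
    change f ⟨b, hBQ hb⟩ = f ⟨b + p, hx⟩
    rw [← sub_eq_zero, ← map_sub, ← LieHom.mem_ker, hf]
    change b - (b + p) ∈ P
    rw [sub_add_cancel_left]
    exact P.neg_mem hp
  have h1 : IsSolvable (Q ⧸ I) := hsurj.lieAlgebra_isSolvable
  have h2 : IsSolvable f.ker := by rw [hf]; infer_instance
  exact isSolvable_of_ker f

end General

/-! ### The nilradical of a Borel subalgebra -/

/-- Let all eigenvalues of `ad h` be real and let the Borel subalgebra `B` lie in the generalized
eigenspace of `ad h` for `0`. Then `ad h` is nilpotent. Otherwise the generalized eigenspace for an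
eigenvalue of maximal absolute value is a nonzero abelian subspace that is normalized by `B` and
meets `B` in zero, and adding it to `B` gives a larger solvable subalgebra. -/
theorem isNilpotent_ad_of_isBorel_le {𝔤 : Type*} [LieRing 𝔤] [LieAlgebra ℝ 𝔤]
    [FiniteDimensional ℝ 𝔤] {B : LieSubalgebra ℝ 𝔤} (hB : IsBorel B) {h : 𝔤}
    (htop : ⨆ μ, (ad ℝ 𝔤 h).maxGenEigenspace μ = ⊤)
    (hBh : ∀ b ∈ B, b ∈ (ad ℝ 𝔤 h).maxGenEigenspace 0) : IsNilpotent (ad ℝ 𝔤 h) := by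
  classical
  set E : ℝ → Submodule ℝ 𝔤 := fun μ => (ad ℝ 𝔤 h).maxGenEigenspace μ with hE
  have hlie : ∀ {μ ν : ℝ} {x y : 𝔤}, x ∈ E μ → y ∈ E ν → ⁅x, y⁆ ∈ E (μ + ν) :=
    fun hx hy => LieModule.lie_mem_maxGenEigenspace_toEnd hx hy
  have hind : iSupIndep E := (ad ℝ 𝔤 h).independent_genEigenspace _
  have hzero : ∀ μ : ℝ, μ ≠ 0 → E μ = ⊥ := by
    by_contra! hcon
    have hfin : {μ : ℝ | μ ≠ 0 ∧ E μ ≠ ⊥}.Finite :=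
      (WellFoundedGT.finite_ne_bot_of_iSupIndep hind).subset fun μ hμ => hμ.2
    obtain ⟨r, ⟨hr0, hr⟩, hmax⟩ := hfin.exists_maximalFor (fun μ => |μ|) _ hcon
    -- `r + r` exceeds `r` in absolute value, so it is not an eigenvalue.
    have h2r : E (r + r) = ⊥ := by
      by_contra hne
      have h1 : |r| < |r + r| := by
        rw [← two_mul, abs_mul, abs_two]
        linarith [abs_pos.2 hr0]
      exact absurd (hmax ⟨by simpa [← two_mul] using hr0, hne⟩ h1.le) (not_le.2 h1)
    have hBP : ∀ b ∈ B, ∀ p ∈ E r, ⁅b, p⁆ ∈ E r := fun b hb p hp => by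
      simpa using hlie (hBh b hb) hp
    have hPP : ∀ p ∈ E r, ∀ q ∈ E r, ⁅p, q⁆ = 0 := fun p hp q hq => by
      simpa [h2r] using hlie hp hq
    let Q : LieSubalgebra ℝ 𝔤 :=
      { B.toSubmodule ⊔ E r with
        lie_mem' := by
          intro x y hx hy
          obtain ⟨b, hb, p, hp, rfl⟩ := Submodule.mem_sup.1 hx
          obtain ⟨c, hc, q, hq, rfl⟩ := Submodule.mem_sup.1 hy
          have h1 : ⁅b + p, c + q⁆ = ⁅b, c⁆ + (⁅b, q⁆ - ⁅c, p⁆) := by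
            rw [add_lie, lie_add, lie_add, hPP p hp q hq, ← lie_skew p c]
            abel
          rw [h1]
          exact Submodule.add_mem_sup (B.lie_mem hb hc)
            ((E r).sub_mem (hBP b hb q hq) (hBP c hc p hp)) }
    have hsolvB : IsSolvable B := hB.prop
    have hsolv : IsSolvable Q := isSolvable_of_sup (B := B) (P := E r) rfl hBP hPP
    have hBQ : B ≤ Q := fun x hx => Submodule.mem_sup_left hx
    have hQB : Q ≤ B := hB.le_of_ge hsolv hBQ
    refine hr ((Submodule.eq_bot_iff _).2 fun x hx => ?_)
    have hx0 : x ∈ E 0 := hBh x (hQB (Submodule.mem_sup_right hx))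
    exact Submodule.disjoint_def.1 (hind.pairwiseDisjoint hr0) x hx hx0
  have h1 : E 0 = ⊤ := by
    rw [eq_top_iff, ← htop]
    refine iSup_le fun μ => ?_
    by_cases hμ : μ = 0
    · rw [hμ]
    · exact (hzero μ hμ).trans_le bot_le
  refine Module.End.isNilpotent_iff_of_finite.mpr fun m => ?_
  have hm : m ∈ E 0 := h1 ▸ Submodule.mem_top
  simpa [hE, Module.End.mem_maxGenEigenspace] using hm

section Ideal

variable {R 𝔤 : Type*} [CommRing R] [LieRing 𝔤] [LieAlgebra R 𝔤]

theorem mem_maxGenEigenspace_ad_of_mem_nilpotent_ideal (B : LieSubalgebra R 𝔤) (N : LieIdeal R B)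
    [LieRing.IsNilpotent N] {h : B} (hh : h ∈ N) {b : 𝔤} (hb : b ∈ B) :
    b ∈ (ad R 𝔤 (h : 𝔤)).maxGenEigenspace 0 := by
  obtain ⟨n, hn⟩ := LieModule.isNilpotent_toEnd_of_isNilpotent R N N ⟨h, hh⟩
  have hpow : ∀ (m : ℕ) (y : N), ((ad R 𝔤 (h : 𝔤)) ^ m) ((y : B) : 𝔤) =
      ((((LieModule.toEnd R N N ⟨h, hh⟩) ^ m) y : N) : B) := by
    intro m
    induction m with
    | zero => intro y; rfl
    | succ m ih =>
      intro y
      rw [pow_succ, pow_succ, Module.End.mul_apply, Module.End.mul_apply, ← ih]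
      rfl
  -- One application of `ad h` moves `b` into `N`, where `ad h` is nilpotent.
  have hmem : ⁅h, (⟨b, hb⟩ : B)⁆ ∈ N := by
    rw [← lie_skew]
    exact N.neg_mem (N.lie_mem hh)
  rw [Module.End.mem_maxGenEigenspace]
  refine ⟨n + 1, ?_⟩
  rw [zero_smul, sub_zero, pow_succ, Module.End.mul_apply]
  refine (hpow n ⟨_, hmem⟩).trans ?_
  rw [hn]
  rfl

/-- An ideal `N` of a subalgebra `B`, seen as a subspace of the whole Lie algebra that is stable
under the adjoint action of a subalgebra `C` of `B`. -/
def idealToSubmodule {C B : LieSubalgebra R 𝔤} (hCB : C ≤ B) (N : LieIdeal R B) :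
    LieSubmodule R C 𝔤 :=
  { N.toSubmodule.map B.toSubmodule.subtype with
    lie_mem := by
      rintro c _ ⟨n, hn, rfl⟩
      exact ⟨⁅(⟨c, hCB c.2⟩ : B), n⁆, N.lie_mem hn, rfl⟩ }

end Ideal

/-- In a semisimple real Lie algebra with a split Cartan subalgebra `C`, a nilpotent ideal `N` of a
Borel subalgebra containing `C` acts nilpotently on every finite-dimensional module. It is the sum
of its intersections with the weight spaces of `C`: those for nonzero weights are ad-nilpotent
because `ad` shifts weights, the one for the weight zero because the Borel subalgebra is maximal. -/
theorem isNilpotent_toEnd_of_mem_nilradical {𝔤 : Type*} [LieRing 𝔤] [LieAlgebra ℝ 𝔤]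
    [FiniteDimensional ℝ 𝔤] [IsSemisimple ℝ 𝔤] {C B : LieSubalgebra ℝ 𝔤} (hC : IsSplitCartan C)
    (hB : IsBorel B) (hCB : C ≤ B) (N : LieIdeal ℝ B) [LieRing.IsNilpotent N]
    {M : Type*} [AddCommGroup M] [Module ℝ M] [LieRingModule 𝔤 M] [LieModule ℝ 𝔤 M]
    [FiniteDimensional ℝ M] (n : N) : IsNilpotent (LieModule.toEnd ℝ N M n) := by
  have hcartan : C.IsCartanSubalgebra := hC.1
  have htri : LieModule.IsTriangularizable ℝ C 𝔤 :=
    ⟨fun c => Module.End.iSup_maxGenEigenspace_eq_top_of_splits (hC.2 c c.2)⟩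
  set N' := idealToSubmodule hCB N
  suffices key : ∀ x ∈ N', ∀ y : N, ((y : B) : 𝔤) = x → IsNilpotent (LieModule.toEnd ℝ N M y) from
    key _ ⟨n, n.2, rfl⟩ n rfl
  intro x hx
  rw [LieModule.eq_iSup_inf_genWeightSpace ℝ C 𝔤 N'] at hx
  induction hx using LieSubmodule.iSup_induction' with
  | zero =>
    intro y hy
    have : y = 0 := by ext; simpa using hy
    simp [this]
  | mem χ z hz =>
    rintro y rfl
    change IsNilpotent (LieModule.toEnd ℝ 𝔤 M ((y : B) : 𝔤))
    refine LieModule.isNilpotent_toEnd_of_isNilpotent_ad (IsSemisimple.derivedSeries_eq_top 1) ?_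
    by_cases hχ : (χ : C → ℝ) = 0
    · have hyC : ((y : B) : 𝔤) ∈ C := by
        have := hz.2
        rw [hχ] at this
        simpa using this
      exact isNilpotent_ad_of_isBorel_le hB
        (htri.maxGenEigenspace_eq_top ⟨_, hyC⟩)
        fun b hb => mem_maxGenEigenspace_ad_of_mem_nilpotent_ideal B N y.2 hb
    · exact isNilpotent_ad_of_mem_rootSpace C hχ hz.2
  | add z w hz hw ihz ihw =>
    intro y hy
    rw [← LieModule.eq_iSup_inf_genWeightSpace ℝ C 𝔤 N'] at hz hw
    obtain ⟨z', hz', rfl⟩ := hz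
    obtain ⟨w', hw', rfl⟩ := hw
    have hsum : y = ⟨z', hz'⟩ + ⟨w', hw'⟩ := by
      ext; simpa using hy
    rw [hsum]
    exact LieModule.isNilpotent_toEnd_add (ihz _ rfl) (ihw _ rfl)

end LieAlgebra

/-! ### The centralizer of a frame of commuting vector fields -/

namespace SmoothVF

variable {K : ℕ} {U V : Opens (EuclideanSpace ℝ (Fin K))}

/-- The endomorphism of `ℝ^K` that sends the `i`-th standard basis vector to the value at `y` of the
vector field `X i`. It is invertible iff the values of the fields form a basis. -/
noncomputable def frameMap (X : Fin K → SmoothVF V) (y : EuclideanSpace ℝ (Fin K)) :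
    EuclideanSpace ℝ (Fin K) →L[ℝ] EuclideanSpace ℝ (Fin K) :=
  ∑ i, (EuclideanSpace.proj i : EuclideanSpace ℝ (Fin K) →L[ℝ] ℝ).smulRight ((X i).1 y)

theorem frameMap_apply (X : Fin K → SmoothVF V) (y v : EuclideanSpace ℝ (Fin K)) :
    frameMap X y v = ∑ i, v i • (X i).1 y := by
  simp [frameMap]

theorem contDiffAt_frameMap (X : Fin K → SmoothVF V) {y : EuclideanSpace ℝ (Fin K)} (hy : y ∈ V) :
    ContDiffAt ℝ ∞ (frameMap X) y := by
  unfold frameMap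
  refine ContDiffAt.sum fun i _ => ?_
  exact ((ContinuousLinearMap.smulRightL ℝ _ _ (EuclideanSpace.proj i)).contDiff.contDiffAt).comp y
    ((X i).contDiffAt hy)

theorem lie_apply (X Y : SmoothVF V) (y : EuclideanSpace ℝ (Fin K)) :
    (⁅X, Y⁆ : SmoothVF V).1 y = fderiv ℝ Y.1 y (X.1 y) - fderiv ℝ X.1 y (Y.1 y) := rfl

/-- Let `Y` commute with the commuting fields `X i`, which form a frame at `y`. The coefficient
function `f` of `Y` in this frame has derivative zero at `y`, because the bracket of `X j` with
`∑ i, f i • X i` is `∑ i, (X j) (f i) • X i`. -/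
theorem fderiv_eq_zero_of_lie_eq_zero (X : Fin K → SmoothVF V)
    (Y : SmoothVF V) (hX : ∀ i j, ⁅X i, X j⁆ = 0) (hY : ∀ i, ⁅X i, Y⁆ = 0)
    {y : EuclideanSpace ℝ (Fin K)} (hy : y ∈ V) (hunit : IsUnit (frameMap X y))
    {f : EuclideanSpace ℝ (Fin K) → EuclideanSpace ℝ (Fin K)} (hf : DifferentiableAt ℝ f y)
    (hYf : Y.1 =ᶠ[nhds y] fun z => frameMap X z (f z)) : fderiv ℝ f y = 0 := by
  have hinj : Function.Injective (frameMap X y) :=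
    (ContinuousLinearMap.isUnit_iff_bijective.1 hunit).1
  have hsurj : Function.Surjective (frameMap X y) :=
    (ContinuousLinearMap.isUnit_iff_bijective.1 hunit).2
  have hM : DifferentiableAt ℝ (frameMap X) y :=
    (contDiffAt_frameMap X hy).differentiableAt (by simp)
  have hMd : ∀ v w, fderiv ℝ (frameMap X) y v w = ∑ i, w i • fderiv ℝ (X i).1 y v := by
    intro v w
    have h1 : HasFDerivAt (fun z => frameMap X z w)
        (∑ i, w i • fderiv ℝ (X i).1 y) y := by
      simp only [frameMap_apply]
      exact HasFDerivAt.fun_sum fun i _ => ((X i).differentiableAt hy).hasFDerivAt.const_smul (w i)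
    have h2 := hM.hasFDerivAt.clm_apply (hasFDerivAt_const w y)
    have h3 := congrArg (fun T => T v) (h2.unique h1)
    simpa using h3
  have hYd : ∀ v, fderiv ℝ Y.1 y v =
      frameMap X y (fderiv ℝ f y v) + fderiv ℝ (frameMap X) y v (f y) := by
    intro v
    rw [hYf.fderiv_eq, (hM.hasFDerivAt.clm_apply hf.hasFDerivAt).fderiv]
    simp
  have hXj : ∀ j, fderiv ℝ f y ((X j).1 y) = 0 := by
    intro j
    apply hinj
    have h1 : (⁅X j, Y⁆ : SmoothVF V).1 y = 0 := by rw [hY j]; rfl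
    have h2 : ∀ i, fderiv ℝ (X i).1 y ((X j).1 y) = fderiv ℝ (X j).1 y ((X i).1 y) := by
      intro i
      have : (⁅X j, X i⁆ : SmoothVF V).1 y = 0 := by rw [hX j i]; rfl
      rw [lie_apply] at this
      exact sub_eq_zero.1 this
    rw [lie_apply, hYd, hYf.eq_of_nhds, hMd, frameMap_apply X y (f y), map_sum] at h1
    simp only [map_smul, h2, add_sub_cancel_right] at h1
    rw [h1, map_zero]
  ext1 v
  obtain ⟨w, rfl⟩ := hsurj v
  simp [frameMap_apply, hXj]

/-- A vector field that commutes with `K` commuting vector fields spanning the tangent space at `x`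
is a linear combination of them with constant coefficients near `x`. -/
theorem eventually_eq_sum_of_lie_eq_zero (X : Fin K → SmoothVF V) (Y : SmoothVF V)
    (hX : ∀ i j, ⁅X i, X j⁆ = 0) (hY : ∀ i, ⁅X i, Y⁆ = 0)
    {x : EuclideanSpace ℝ (Fin K)} (hx : x ∈ V)
    (hXx : ∀ i, (X i).1 x = EuclideanSpace.single i 1) :
    ∃ c : Fin K → ℝ, ∀ᶠ y in nhds x, Y.1 y = (∑ i, c i • X i : SmoothVF V).1 y := by
  have hMx : frameMap X x = 1 := by
    ext1 v
    rw [frameMap_apply]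
    simp only [hXx]
    ext j
    simp [Finset.sum_apply, Pi.single_apply]
  set f : EuclideanSpace ℝ (Fin K) → EuclideanSpace ℝ (Fin K) :=
    fun y => Ring.inverse (frameMap X y) (Y.1 y) with hf
  have hunit : ∀ᶠ y in nhds x, IsUnit (frameMap X y) := by
    have hopen : IsOpen {T : EuclideanSpace ℝ (Fin K) →L[ℝ] EuclideanSpace ℝ (Fin K) | IsUnit T} :=
      Units.isOpen
    exact (contDiffAt_frameMap X hx).continuousAt.eventually
      (hopen.mem_nhds (by rw [Set.mem_ofPred_eq, hMx]; exact isUnit_one))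
  obtain ⟨ε, hε, hball⟩ := Metric.eventually_nhds_iff_ball.1 (hunit.and (V.isOpen.mem_nhds hx))
  have hYf : ∀ y ∈ Metric.ball x ε, Y.1 y = frameMap X y (f y) := by
    intro y hy
    have := congrArg (fun T => T (Y.1 y)) (Ring.mul_inverse_cancel _ (hball y hy).1)
    exact this.symm
  have hdiff : ∀ y ∈ Metric.ball x ε, DifferentiableAt ℝ f y := by
    intro y hy
    obtain ⟨u, hu⟩ := (hball y hy).1
    have h1 : DifferentiableAt ℝ Ring.inverse (frameMap X y) := by
      rw [← hu]; exact (contDiffAt_ringInverse ℝ u (n := 1)).differentiableAt (by simp)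
    exact (h1.comp y ((contDiffAt_frameMap X (hball y hy).2).differentiableAt (by simp))).clm_apply
      (Y.differentiableAt (hball y hy).2)
  have hzero : ∀ y ∈ Metric.ball x ε, fderiv ℝ f y = 0 := fun y hy =>
    fderiv_eq_zero_of_lie_eq_zero X Y hX hY (hball y hy).2 (hball y hy).1 (hdiff y hy)
      (Filter.eventuallyEq_of_mem (Metric.isOpen_ball.mem_nhds hy) hYf)
  refine ⟨fun i => f x i, Filter.eventually_of_mem (Metric.ball_mem_nhds x hε) fun y hy => ?_⟩
  have hconst : f y = f x := Metric.isOpen_ball.is_const_of_fderiv_eq_zero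
    (convex_ball x ε).isPreconnected (fun z hz => (hdiff z hz).differentiableWithinAt)
    hzero hy (Metric.mem_ball_self hε)
  rw [hYf y hy, hconst, frameMap_apply]
  simp

theorem exists_apply_eq_of_orbitDim_eq {A : LieSubalgebra ℝ (SmoothVF U)}
    {x : EuclideanSpace ℝ (Fin K)} (h : orbitDim A x = K) (v : EuclideanSpace ℝ (Fin K)) :
    ∃ X ∈ A, X.1 x = v := by
  let ev : A →ₗ[ℝ] EuclideanSpace ℝ (Fin K) :=
    (LinearMap.proj x).comp ((smoothVectorFields U).subtype.comp A.toSubmodule.subtype)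
  have hset : {v : EuclideanSpace ℝ (Fin K) | ∃ X ∈ A, X.1 x = v} = LinearMap.range ev := by
    ext v
    constructor
    · rintro ⟨X, hX, rfl⟩; exact ⟨⟨X, hX⟩, rfl⟩
    · rintro ⟨X, rfl⟩; exact ⟨X, X.2, rfl⟩
  rw [orbitDim, hset, Submodule.span_eq] at h
  have htop : LinearMap.range ev = ⊤ :=
    Submodule.eq_top_of_finrank_eq (by rw [h, finrank_euclideanSpace_fin])
  obtain ⟨X, hX⟩ := LinearMap.range_eq_top.1 htop v
  exact ⟨X, X.2, hX⟩

end SmoothVF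

/-! ### The action on the radical and Levi complements -/

namespace LieAlgebra

/-- A homomorphism `f` from a semisimple Lie algebra has no nonzero value in a solvable subalgebra
(the range of `g`) that the image of `f` normalizes: the preimage of that subalgebra is an ideal,
hence perfect, and a perfect Lie algebra has only the zero homomorphism to a solvable one. -/
theorem IsSemisimple.map_eq_zero_of_mem_range {k L L' S : Type*} [CommRing k] [LieRing L]
    [LieAlgebra k L] [IsSemisimple k L] [LieRing L'] [LieAlgebra k L'] [LieRing S] [LieAlgebra k S]
    [IsSolvable S] (f : L →ₗ⁅k⁆ L') (g : S →ₗ⁅k⁆ L')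
    (hfg : ∀ x, ∀ y ∈ g.range, ⁅f x, y⁆ ∈ g.range) {x : L} (hx : f x ∈ g.range) : f x = 0 := by
  let J : LieIdeal k L :=
    { g.range.toSubmodule.comap (f : L →ₗ[k] L') with
      lie_mem := by
        intro y z hz
        change f ⁅y, z⁆ ∈ g.range
        rw [LieHom.map_lie]
        exact hfg y _ hz }
  let fJ : J →ₗ⁅k⁆ g.range :=
    { toFun := fun z => ⟨f z, z.2⟩
      map_add' := fun a b => Subtype.ext (map_add f (a : L) b)
      map_smul' := fun c a => Subtype.ext (map_smul f c (a : L))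
      map_lie' := fun {a b} => Subtype.ext (LieHom.map_lie f (a : L) b) }
  have hperf : ∀ n, derivedSeries k J n = ⊤ := fun n => by
    refine LieIdeal.derivedSeries_eq_top n ?_
    rw [LieIdeal.derivedSeries_eq_derivedSeriesOfIdeal_comap, derivedSeriesOfIdeal_succ,
      derivedSeriesOfIdeal_zero, IsSemisimple.lie_self_eq]
    ext z
    simp
  obtain ⟨n, hn⟩ := IsSolvable.solvable k g.range
  have h1 := LieIdeal.derivedSeries_map_le (f := fJ) n
  rw [hperf, hn, le_bot_iff] at h1
  have h2 : fJ ⟨x, hx⟩ ∈ (⊤ : LieIdeal k J).map fJ := LieIdeal.mem_map (LieSubmodule.mem_top _)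
  rw [h1, LieSubmodule.mem_bot] at h2
  exact congrArg Subtype.val h2

/-- By Engel's theorem, a nonzero ideal `R` of `G` contains a nonzero element that commutes with the
image of the nilradical of the Borel subalgebra. -/
theorem exists_ne_zero_forall_mem_nilradical_lie_eq_zero {L G : Type*} [LieRing L] [LieAlgebra ℝ L]
    [FiniteDimensional ℝ L] [IsSemisimple ℝ L] {C B : LieSubalgebra ℝ L} (hC : IsSplitCartan C)
    (hB : IsBorel B) (hCB : C ≤ B) (N : LieIdeal ℝ B) [LieRing.IsNilpotent N]
    [LieRing G] [LieAlgebra ℝ G] [FiniteDimensional ℝ G] (φ : L →ₗ⁅ℝ⁆ G) {R : LieIdeal ℝ G}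
    (hR : R ≠ ⊥) : ∃ y ∈ R, y ≠ 0 ∧ ∀ n ∈ N, ⁅φ n, y⁆ = 0 := by
  let _ : LieRingModule L R := LieRingModule.compLieHom R φ
  have _ : LieModule ℝ L R := LieModule.compLieHom R φ
  have _ : Nontrivial R := (LieSubmodule.nontrivial_iff_ne_bot ℝ G G).2 hR
  have _ : LieModule.IsNilpotent N R := LieModule.isNilpotent_iff_forall'.2 fun n =>
    isNilpotent_toEnd_of_mem_nilradical hC hB hCB N n
  have _ : Nontrivial (LieModule.maxTrivSubmodule ℝ N R) :=
    LieModule.nontrivial_max_triv_of_isNilpotent ℝ N R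
  obtain ⟨⟨y, hy⟩, hy0⟩ := exists_ne (0 : LieModule.maxTrivSubmodule ℝ N R)
  refine ⟨y, y.2, fun h => hy0 ?_, fun n hn => ?_⟩
  · exact Subtype.ext (Subtype.ext h)
  · exact congrArg Subtype.val (hy ⟨n, hn⟩)

end LieAlgebra

theorem proposition3p1 (K : ℕ) (U : Opens (EuclideanSpace ℝ (Fin K)))
    -- a semisimple (finite-dimensional) Lie algebra of vector fields on `U`
    (L : LieSubalgebra ℝ (SmoothVF U)) [FiniteDimensional ℝ L] [LieAlgebra.IsSemisimple ℝ L]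
    -- a split Cartan subalgebra, a Borel subalgebra containing it, and the nilradical of the latter
    (C B : LieSubalgebra ℝ L) (hC : IsSplitCartan C) (hB : IsBorel B) (hCB : C ≤ B)
    (N : LieIdeal ℝ B) (hN : IsNilradical N)
    -- an abelian subalgebra of rank `K` of the nilradical
    (A : LieSubalgebra ℝ (SmoothVF U))
    (hAN : ∀ X ∈ A, ∃ n : B, n ∈ N ∧ ((n : L) : SmoothVF U) = X)
    (hA : IsLieAbelian A) (hrank : HasRank A K)
    -- a finite-dimensional algebra of local vector fields containing `L` (restricted to its domain)
    (V : Opens (EuclideanSpace ℝ (Fin K))) (hVU : V ≤ U)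
    (G : LieSubalgebra ℝ (SmoothVF V)) [FiniteDimensional ℝ G]
    (hLG : L.map (SmoothVF.restrict hVU) ≤ G) :
    ¬ IsProperLeviComplement ((L.map (SmoothVF.restrict hVU)).comap G.incl) := by
  rintro ⟨⟨-, hcompl⟩, -, hne_top⟩
  have hNnil : LieRing.IsNilpotent N := hN.1
  set R := LieAlgebra.radical ℝ G
  have hR : R ≠ ⊥ := by
    intro h
    rw [h, LieSubmodule.bot_toSubmodule] at hcompl
    exact hne_top (by
      rw [← LieSubalgebra.toSubmodule_inj, LieSubalgebra.top_toSubmodule]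
      simpa using hcompl.sup_eq_top)
  let φ : L →ₗ⁅ℝ⁆ G :=
    { toFun := fun X => ⟨SmoothVF.restrict hVU X, hLG ⟨X, X.2, rfl⟩⟩
      map_add' := fun X Y => Subtype.ext (map_add (SmoothVF.restrict hVU) (X : SmoothVF U) Y)
      map_smul' := fun c X => Subtype.ext (map_smul (SmoothVF.restrict hVU) c (X : SmoothVF U))
      map_lie' := fun {X Y} =>
        Subtype.ext (LieHom.map_lie (SmoothVF.restrict hVU) (X : SmoothVF U) Y) }
  obtain ⟨Y, hYR, hY0, hYN⟩ :=
    LieAlgebra.exists_ne_zero_forall_mem_nilradical_lie_eq_zero hC hB hCB N φ hR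
  obtain ⟨O, -, hdense, hO, -⟩ := hrank
  -- At a generic point `Y` agrees locally with an element of `A`, hence of `L`; restricted to a
  -- neighbourhood `W`, it lies in the image of `L` and in the image of the radical.
  have hzero : ∀ x ∈ V, x ∈ O → Y.1.1 x = 0 := by
    intro x hxV hxO
    choose X hXA hXx using fun i : Fin K =>
      SmoothVF.exists_apply_eq_of_orbitDim_eq (hO x hxO) (EuclideanSpace.single i 1)
    have hXX : ∀ i j, ⁅SmoothVF.restrict hVU (X i), SmoothVF.restrict hVU (X j)⁆ = 0 := by
      intro i j
      have h : ⁅(⟨X i, hXA i⟩ : A), (⟨X j, hXA j⟩ : A)⁆ = 0 := hA.trivial _ _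
      rw [← LieHom.map_lie, show ⁅X i, X j⁆ = 0 from congrArg Subtype.val h, map_zero]
    have hXY : ∀ i, ⁅SmoothVF.restrict hVU (X i), Y.1⁆ = 0 := by
      intro i
      obtain ⟨n, hn, hnX⟩ := hAN _ (hXA i)
      rw [← hnX]
      exact congrArg Subtype.val (hYN n hn)
    obtain ⟨c, hc⟩ := SmoothVF.eventually_eq_sum_of_lie_eq_zero
      (fun i => SmoothVF.restrict hVU (X i)) Y.1 hXX hXY hxV
      (fun i => by rw [SmoothVF.restrict_apply hVU _ hxV, hXx])
    obtain ⟨W', hW', hWopen, hxW'⟩ := eventually_nhds_iff.1 hc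
    let W : Opens (EuclideanSpace ℝ (Fin K)) := ⟨W', hWopen⟩ ⊓ V
    have hWV : W ≤ V := inf_le_right
    have hxW : x ∈ W := ⟨hxW', hxV⟩
    obtain ⟨n, -, hn⟩ := hAN (∑ i, c i • X i)
      (A.toSubmodule.sum_mem fun i _ => A.smul_mem _ (hXA i))
    let π : G →ₗ⁅ℝ⁆ SmoothVF W := (SmoothVF.restrict hWV).comp G.incl
    let g : R →ₗ⁅ℝ⁆ SmoothVF W := π.comp R.incl
    have hπ : π (φ n) = g ⟨Y, hYR⟩ := by
      refine SmoothVF.ext_on fun z hz => ?_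
      change (SmoothVF.restrict hWV (SmoothVF.restrict hVU ((n : L) : SmoothVF U))).1 z =
        (SmoothVF.restrict hWV Y.1).1 z
      rw [SmoothVF.restrict_apply hWV _ hz, SmoothVF.restrict_apply hWV _ hz, hW' z hz.1, hn,
        map_sum]
      simp only [map_smul]
    have hmem : (π.comp φ) (n : L) ∈ g.range := ⟨⟨Y, hYR⟩, hπ.symm⟩
    have h0 : (π.comp φ) (n : L) = 0 := by
      refine LieAlgebra.IsSemisimple.map_eq_zero_of_mem_range (π.comp φ) g ?_ hmem
      rintro Z _ ⟨r, rfl⟩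
      exact ⟨⟨⁅φ Z, (r : G)⁆, R.lie_mem r.2⟩, LieHom.map_lie π (φ Z) r⟩
    have h1 : (SmoothVF.restrict hWV Y.1).1 x = 0 := by
      have h2 : SmoothVF.restrict hWV Y.1 = 0 := hπ.symm.trans h0
      rw [h2]
      rfl
    rwa [SmoothVF.restrict_apply hWV _ hxW] at h1
  -- The generic points are dense, so `Y` vanishes everywhere by continuity.
  refine hY0 (Subtype.ext (SmoothVF.ext_on fun x hx => ?_))
  by_contra hne
  have hopen : IsOpen ((V : Set (EuclideanSpace ℝ (Fin K))) ∩ Y.1.1 ⁻¹' {0}ᶜ) :=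
    Y.1.2.1.continuousOn.isOpen_inter_preimage V.isOpen isOpen_compl_singleton
  obtain ⟨z, ⟨hzV, hz⟩, hzO⟩ := mem_closure_iff.1 (hdense (hVU hx)) _ hopen ⟨hx, hne⟩
  exact hz (hzero z hzV hzO)
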